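/- Let $V$ be a finite-dimensional vector space over a finite field $F$, with a basis $\mathcal B=\{v_1,\dots,v_n\}$. For $a=a_1v_1+\dots+a_nv_n\in V$ let $S_{\mathcal B}(a)=\{v_i : a_i\neq 0\}$ be the skeleton of $a$. The skeleton intersection graph $\mathbb{IG}(V)$ and the skeleton union graph $\mathbb{UG}(V)$ (with respect to $\mathcal B$) are the simple graphs with vertex set $V\setminus\{0\}$ in which two distinct vertices $a,b$ are adjacent if and only if $S_{\mathcal B}(a)\cap S_{\mathcal B}(b)\neq\emptyset$, respectively $S_{\mathcal B}(a)\cup S_{\mathcal B}(b)=\mathcal B$. A graph is chordal if every cycle of length at least $4$ has a chord (an edge of the graph that is not an edge of the cycle but joins two vertices of the cycle), and perfect if the chromatic number of every induced subgraph equals its clique number. Then: 1. $\mathbb{IG}(V)$ is chordal if and only if $\dim V\le 3$. 2. If $V\neq 0$, then $\mathbb{UG}(V)$ is chordal if and only if either $\dim V=1$, or $\dim V\in\{2,3\}$ and $|F|=2$. 3. $\mathbb{IG}(V)$ is perfect if and only if $\mathbb{UG}(V)$ is perfect, and this occurs if and only if $\dim V\le 4$. -/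

import Mathlib

namespace SkeletonGraphs

/-- A graph is chordal if every cycle of length at least `4` has a chord: an edge of the graph that
is not an edge of the cycle and whose two end vertices lie on the cycle. -/
def IsChordal {α : Type*} (G : SimpleGraph α) : Prop :=
  ∀ (u : α) (c : G.Walk u u), c.IsCycle → 4 ≤ c.length →
    ∃ x ∈ c.support, ∃ y ∈ c.support, G.Adj x y ∧ s(x, y) ∉ c.edges

/-- A graph is perfect if for every induced subgraph the chromatic number equals the
clique number. -/
def IsPerfect {α : Type*} (G : SimpleGraph α) : Prop :=
  ∀ s : Set α, (G.induce s).chromaticNumber = ((G.induce s).cliqueNum : ℕ∞)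

section

variable {ι F V : Type*} [Field F] [AddCommGroup V] [Module F V]

/-- The skeleton of a vector `a` with respect to the basis `B`: the set of those basis vectors
that have a nonzero coefficient in the expansion of `a`. -/
def skeleton (B : Module.Basis ι F V) (a : V) : Set V :=
  {v | ∃ i, B i = v ∧ B.repr a i ≠ 0}

/-- The skeleton intersection graph (nonzero component graph) with respect to the basis `B`:
the vertices are the nonzero vectors, and two distinct ones are adjacent if and only if their
skeletons intersect. -/
def interGraph (B : Module.Basis ι F V) : SimpleGraph {a : V // a ≠ 0} where
  Adj a b := a ≠ b ∧ (skeleton B a.1 ∩ skeleton B b.1).Nonempty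
  symm := ⟨fun a b h => ⟨h.1.symm, by rw [Set.inter_comm]; exact h.2⟩⟩
  loopless := ⟨fun a h => h.1 rfl⟩

/-- The skeleton union graph (nonzero component union graph) with respect to the basis `B`:
the vertices are the nonzero vectors, and two distinct ones are adjacent if and only if the union
of their skeletons is the whole basis. -/
def unionGraph (B : Module.Basis ι F V) : SimpleGraph {a : V // a ≠ 0} where
  Adj a b := a ≠ b ∧ skeleton B a.1 ∪ skeleton B b.1 = Set.range B
  symm := ⟨fun a b h => ⟨h.1.symm, by rw [Set.union_comm]; exact h.2⟩⟩
  loopless := ⟨fun a h => h.1 rfl⟩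

end

end SkeletonGraphs

/-!
Write `supp a` for the set of indices at which the vector `a` has a nonzero coordinate and `Z a` for
its complement. Distinct vertices are adjacent in the skeleton intersection graph if and only if
their sets `supp` intersect, and in the skeleton union graph if and only if their sets `Z` are
disjoint. So both graphs are intersection or disjointness graphs of families of subsets of an
`n`-element set, where `n` is the dimension; a set may occur several times, once for each vector
with that support.

*Chordality.* Large `n` is excluded by squares: the edges of a 4-cycle on four indices for
intersection, the sets `{0}`, `{2}`, `{0, 1}`, `{2, 3}` for disjointness and `n ≥ 4`. If the field
has at least three elements and `n ≥ 2`, the disjointness graph also has a square whose sets are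
`{x}`, `{y}`, `{x}`, `{y}`. In the remaining cases, counting points in the sets of consecutive
vertices of a chordless cycle gives a contradiction
(`isChordal_of_adj_iff_not_disjoint`, `isChordal_of_adj_iff_disjoint_of_injective`).

*Perfection.* For `n ≥ 5`, the pairs `{i, i + 1}` of indices modulo `5` span a pentagon in both
graphs. For `n ≤ 4`, it suffices that each nonempty set of vertices contains a stable set
meeting all its maximum cliques (`isPerfect_of_stable_transversal`): removing such a set lowers the
clique number by one and costs one color. Such stable sets are described explicitly in
`isPerfect_of_adj_iff_not_disjoint` and `isPerfect_of_adj_iff_disjoint`. They work for families with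
repetitions, and thus over every finite field at once.
-/

namespace SkeletonGraphs

/-! ### Perfection through stable transversals of maximum cliques -/

section Graphs

variable {α : Type*} {G : SimpleGraph α}

/-- If every nonempty finite vertex set contains a stable set that meets all its maximum cliques,
then greedy removal of such stable sets colors any vertex set with as many colors as its largest
clique has vertices. -/
theorem exists_coloring_of_stable_transversal
    (h : ∀ s : Finset α, s.Nonempty → ∃ I ⊆ s, (∀ a ∈ I, ∀ b ∈ I, ¬ G.Adj a b) ∧
      ∀ K ⊆ s, G.IsClique (K : Set α) →
        (∀ K' ⊆ s, G.IsClique (K' : Set α) → K'.card ≤ K.card) → ∃ a ∈ K, a ∈ I)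
    (s : Finset α) : ∀ k : ℕ, (∀ K ⊆ s, G.IsClique (K : Set α) → K.card ≤ k) →
      ∃ f : α → ℕ, (∀ a ∈ s, f a < k) ∧ ∀ a ∈ s, ∀ b ∈ s, G.Adj a b → f a ≠ f b := by
  classical
  induction s using Finset.strongInduction with
  | H s ih =>
    intro k hk
    rcases s.eq_empty_or_nonempty with rfl | hs
    · exact ⟨fun _ => 0, by simp, by simp⟩
    obtain ⟨I, hIs, hI, hmeet⟩ := h s hs
    obtain ⟨x, hx⟩ := hs
    have hk1 : 1 ≤ k := by simpa using hk {x} (by simpa using hx) (by simp)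
    by_cases hIe : I.Nonempty
    · have hsub : s \ I ⊂ s := by
        obtain ⟨y, hy⟩ := hIe
        refine Finset.ssubset_iff_subset_ne.2 ⟨Finset.sdiff_subset, fun he => ?_⟩
        have : y ∈ s \ I := he.symm ▸ hIs hy
        exact (Finset.mem_sdiff.1 this).2 hy
      obtain ⟨f, hf, hf'⟩ := ih (s \ I) hsub (k - 1) (by
        intro K hK hKc
        have hKs : K ⊆ s := hK.trans Finset.sdiff_subset
        by_contra hlt
        have hle := hk K hKs hKc
        obtain ⟨a, haK, haI⟩ := hmeet K hKs hKc fun K' h1 h2 => by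
          have := hk K' h1 h2
          omega
        have := hK haK
        simp [haI] at this)
      refine ⟨fun a => if a ∈ I then k - 1 else f a, fun a ha => ?_, fun a ha b hb hab => ?_⟩
      · by_cases haI : a ∈ I
        · simp only [haI, if_true]; omega
        · have := hf a (by simp [ha, haI])
          simp only [haI, if_false]; omega
      · by_cases haI : a ∈ I <;> by_cases hbI : b ∈ I
        · exact absurd hab (hI a haI b hbI)
        · have := hf b (by simp [hb, hbI])
          simp only [haI, hbI, if_true, if_false]; omega
        · have := hf a (by simp [ha, haI])
          simp only [haI, hbI, if_true, if_false]; omega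
        · simpa only [haI, hbI, if_false] using
            hf' a (by simp [ha, haI]) b (by simp [hb, hbI]) hab
    · -- A maximum clique cannot meet the empty set, so this case does not occur.
      exfalso
      obtain ⟨K, hK, hmax⟩ := Finset.exists_max_image
        (s.powerset.filter fun K : Finset α => G.IsClique (K : Set α)) Finset.card
        ⟨∅, by simp⟩
      simp only [Finset.mem_filter, Finset.mem_powerset] at hK hmax
      obtain ⟨a, -, ha⟩ := hmeet K hK.1 hK.2 fun K' h1 h2 => hmax K' ⟨h1, h2⟩
      exact hIe ⟨a, ha⟩

theorem isPerfect_of_stable_transversal [Finite α]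
    (h : ∀ s : Finset α, s.Nonempty → ∃ I ⊆ s, (∀ a ∈ I, ∀ b ∈ I, ¬ G.Adj a b) ∧
      ∀ K ⊆ s, G.IsClique (K : Set α) →
        (∀ K' ⊆ s, G.IsClique (K' : Set α) → K'.card ≤ K.card) → ∃ a ∈ K, a ∈ I) :
    IsPerfect G := by
  classical
  intro t
  refine le_antisymm ?_ SimpleGraph.cliqueNum_le_chromaticNumber
  obtain ⟨f, hf, hf'⟩ := exists_coloring_of_stable_transversal h t.toFinite.toFinset
    (G.induce t).cliqueNum (by
      intro K hK hKc
      have hKt : ∀ a ∈ K, a ∈ t := fun a ha => by simpa using hK ha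
      have hc : (G.induce t).IsClique (K.subtype (· ∈ t) : Set t) := by
        intro a ha b hb hab
        exact hKc (Finset.mem_subtype.1 ha) (Finset.mem_subtype.1 hb) fun he => hab (Subtype.ext he)
      have := SimpleGraph.IsClique.card_le_cliqueNum (tc := hc)
      rwa [Finset.card_subtype, Finset.filter_true_of_mem hKt] at this)
  refine SimpleGraph.Colorable.chromaticNumber_le ⟨SimpleGraph.Coloring.mk
    (fun a => ⟨f a, hf a (by simp)⟩) ?_⟩
  intro a b hab he
  exact hf' a (by simp) b (by simp) hab (Fin.mk.inj_iff.1 he)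

/-- A maximum clique of a vertex set contains every vertex of the set adjacent to all its other
members. -/
theorem mem_of_adj_maximum_clique {s K : Finset α} (hKs : K ⊆ s) (hK : G.IsClique (K : Set α))
    (hmax : ∀ K' ⊆ s, G.IsClique (K' : Set α) → K'.card ≤ K.card) {x : α} (hx : x ∈ s)
    (hadj : ∀ y ∈ K, x ≠ y → G.Adj x y) : x ∈ K := by
  classical
  by_contra hxK
  have := hmax (insert x K) (Finset.insert_subset hx hKs) (by
    rw [Finset.coe_insert]
    exact hK.insert fun y hy hxy => hadj y hy hxy)
  rw [Finset.card_insert_of_notMem hxK] at this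
  omega

/-- A perfect graph has no induced pentagon, whose chromatic number is `3` and whose clique number
is at most `2`. -/
theorem not_isPerfect_of_pentagon (f : Fin 5 → α)
    (hadj : ∀ i j, G.Adj (f i) (f j) ↔ j = i + 1 ∨ i = j + 1) : ¬ IsPerfect G := by
  intro hG
  have hchi := hG (Set.range f)
  obtain ⟨K, hK⟩ := (G.induce (Set.range f)).exists_isNClique_cliqueNum
  have hno : ∀ i j k : Fin 5, (j = i + 1 ∨ i = j + 1) → (k = i + 1 ∨ i = k + 1) →
      (k = j + 1 ∨ j = k + 1) → False := by decide
  have h2 : (G.induce (Set.range f)).cliqueNum ≤ 2 := by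
    by_contra hlt
    obtain ⟨⟨_, a, rfl⟩, ⟨_, b, rfl⟩, ⟨_, c, rfl⟩, ha, hb, hc, hab, hac, hbc⟩ :=
      Finset.two_lt_card_iff.1 (hK.card_eq ▸ not_le.1 hlt)
    exact hno a b c ((hadj a b).1 (hK.isClique ha hb hab)) ((hadj a c).1 (hK.isClique ha hc hac))
      ((hadj b c).1 (hK.isClique hb hc hbc))
  have hcol : (G.induce (Set.range f)).Colorable 2 :=
    (SimpleGraph.chromaticNumber_le_iff_colorable.1 hchi.le).mono h2
  obtain ⟨C⟩ := hcol
  have hne : ∀ i, C ⟨f i, i, rfl⟩ ≠ C ⟨f (i + 1), i + 1, rfl⟩ := fun i =>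
    C.valid ((hadj i (i + 1)).2 (Or.inl rfl))
  have h0 := hne 0
  have h1 := hne 1
  have h2 := hne 2
  have h3 := hne 3
  have h4 := hne 4
  simp only [Fin.isValue, Fin.reduceAdd] at h0 h1 h2 h3 h4
  omega

/-! ### Chordless cycles -/

/-- Around a chordless cycle, vertices at distance two are distinct and not adjacent; here this is
recorded for five consecutive vertices, the last of which is the first one if the cycle has
length `4`. -/
theorem isChordal_of_forall_path
    (h : ∀ v : ℕ → α, (∀ i < 4, G.Adj (v i) (v (i + 1))) →
      (∀ i < 3, v i ≠ v (i + 2) ∧ ¬ G.Adj (v i) (v (i + 2))) → False) : IsChordal G := by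
  intro u c hc hlen
  by_contra hno
  push Not at hno
  have hinj : ∀ i j, i < c.length → j < c.length → c.getVert i = c.getVert j → i = j :=
    fun i j hi hj he => hc.getVert_injOn' (by simp only [Set.mem_ofPred_eq]; omega)
      (by simp only [Set.mem_ofPred_eq]; omega) he
  -- Positions on the cycle are compared modulo its length, the base point having positions `0`
  -- and `c.length`.
  have hinj' : ∀ i j, i ≤ c.length → j ≤ c.length → c.getVert i = c.getVert j →
      i = j ∨ (i = 0 ∧ j = c.length) ∨ (i = c.length ∧ j = 0) := by
    intro i j hi hj he
    rcases hi.lt_or_eq with hi | rfl <;> rcases hj.lt_or_eq with hj | rfl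
    · exact Or.inl (hinj i j hi hj he)
    · have := hinj i 0 hi (by omega) (by simpa using he)
      omega
    · have := hinj 0 j (by omega) hj (by simpa using he)
      omega
    · exact Or.inl rfl
  refine h c.getVert (fun i hi => c.adj_getVert_succ (by omega)) fun i hi =>
    ⟨fun he => ?_, fun ha => ?_⟩
  · have := hinj' i (i + 2) (by omega) (by omega) he
    omega
  · have := hno _ (c.getVert_mem_support i) _ (c.getVert_mem_support (i + 2)) ha
    rw [SimpleGraph.Walk.mk_mem_edges_iff_exists] at this
    obtain ⟨j, hj, he⟩ := this
    rcases Sym2.eq_iff.1 he with ⟨h1, h2⟩ | ⟨h1, h2⟩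
    · have := hinj' _ _ (by omega) (by omega) h1
      have := hinj' _ _ (by omega) (by omega) h2
      omega
    · have := hinj' _ _ (by omega) (by omega) h1
      have := hinj' _ _ (by omega) (by omega) h2
      omega

theorem not_isChordal_of_square {a b c d : α} (hab : G.Adj a b) (hbc : G.Adj b c) (hcd : G.Adj c d)
    (hda : G.Adj d a) (hac : ¬ G.Adj a c) (hbd : ¬ G.Adj b d) (hac' : a ≠ c) (hbd' : b ≠ d) :
    ¬ IsChordal G := by
  intro h
  obtain ⟨x, hx, y, hy, hxy, he⟩ := h a (.cons hab (.cons hbc (.cons hcd (.cons hda .nil)))) (by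
    have := hab.ne; have := hbc.ne; have := hcd.ne; have := hda.ne
    simp only [SimpleGraph.Walk.isCycle_def, SimpleGraph.Walk.isTrail_def]
    simp
    grind) (by simp)
  have hca := fun h : G.Adj c a => hac h.symm
  have hdb := fun h : G.Adj d b => hbd h.symm
  simp only [SimpleGraph.Walk.support_cons, SimpleGraph.Walk.support_nil, List.mem_cons,
    List.not_mem_nil, or_false] at hx hy
  simp only [SimpleGraph.Walk.edges_cons, SimpleGraph.Walk.edges_nil, List.mem_cons,
    List.not_mem_nil, or_false, not_or] at he
  rcases hx with rfl | rfl | rfl | rfl | rfl <;> rcases hy with rfl | rfl | rfl | rfl | rfl <;>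
    simp_all [Sym2.eq_swap]

end Graphs

/-! ### Families of subsets of a set with at most four elements -/

section Families

variable {α ι : Type*} [Fintype ι] [DecidableEq ι] {G : SimpleGraph α} {φ : α → Finset ι}

/-- For the intersection graph, the stable set is built around a vertex `a` whose set `φ a` is
largest: take `a` with a vertex carrying the complement of `φ a`, if there is one, and otherwise
with one vertex for each singleton disjoint from `φ a` that occurs. -/
theorem isPerfect_of_adj_iff_not_disjoint [Finite α] (hι : Fintype.card ι ≤ 4)
    (hφ : ∀ a, (φ a).Nonempty) (hG : ∀ a b, G.Adj a b ↔ a ≠ b ∧ ¬ Disjoint (φ a) (φ b)) :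
    IsPerfect G := by
  classical
  refine isPerfect_of_stable_transversal fun s hs => ?_
  obtain ⟨a, has, hmaxa⟩ := Finset.exists_max_image s (fun x => (φ x).card) hs
  -- A maximum clique avoiding a vertex contains a vertex with a disjoint set.
  have key : ∀ K ⊆ s, G.IsClique (K : Set α) →
      (∀ K' ⊆ s, G.IsClique (K' : Set α) → K'.card ≤ K.card) → ∀ x ∈ s, x ∉ K →
        ∃ y ∈ K, Disjoint (φ x) (φ y) := by
    intro K hKs hK hmax x hx hxK
    by_contra! hno
    exact hxK (mem_of_adj_maximum_clique hKs hK hmax hx fun y hy hxy =>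
      (hG x y).2 ⟨hxy, hno y hy⟩)
  have meet : ∀ K : Finset α, G.IsClique (K : Set α) → ∀ x ∈ K, ∀ y ∈ K,
      ¬ Disjoint (φ x) (φ y) := by
    intro K hK x hx y hy
    by_cases hxy : x = y
    · subst hxy
      simpa using (hφ x).ne_empty
    · exact ((hG x y).1 (hK hx hy hxy)).2
  by_cases hc : ∃ b ∈ s, φ b = (φ a)ᶜ
  · obtain ⟨b, hbs, hb⟩ := hc
    have hab : Disjoint (φ a) (φ b) := hb ▸ disjoint_compl_right
    refine ⟨{a, b}, by simp [Finset.insert_subset_iff, has, hbs], ?_, ?_⟩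
    · intro x hx y hy hxy
      rw [hG] at hxy
      simp only [Finset.mem_insert, Finset.mem_singleton] at hx hy
      rcases hx with rfl | rfl <;> rcases hy with rfl | rfl
      · exact hxy.1 rfl
      · exact hxy.2 hab
      · exact hxy.2 hab.symm
      · exact hxy.1 rfl
    · intro K hKs hK hmax
      by_contra! hno
      obtain ⟨x, hxK, hx⟩ := key K hKs hK hmax a has fun h => hno a h (by simp)
      obtain ⟨y, hyK, hy⟩ := key K hKs hK hmax b hbs fun h => hno b h (by simp)
      rw [hb] at hy
      exact meet K hK y hyK x hxK ((hx.mono_left (disjoint_compl_left_iff.1 hy)))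
  · have hg : ∀ i, ∃ g, (∃ x ∈ s, φ x = {i}) → g ∈ s ∧ φ g = {i} := by
      intro i
      by_cases h : ∃ x ∈ s, φ x = {i}
      · obtain ⟨x, hx⟩ := h
        exact ⟨x, fun _ => hx⟩
      · exact ⟨a, fun h' => absurd h' h⟩
    choose g hg using hg
    refine ⟨insert a ((Finset.univ.filter fun i => i ∉ φ a ∧ ∃ x ∈ s, φ x = {i}).image g),
      ?_, ?_, ?_⟩
    · intro x hx
      simp only [Finset.mem_insert, Finset.mem_image, Finset.mem_filter, Finset.mem_univ,
        true_and] at hx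
      rcases hx with rfl | ⟨i, hi, rfl⟩
      · exact has
      · exact (hg i hi.2).1
    · intro x hx y hy hxy
      rw [hG] at hxy
      simp only [Finset.mem_insert, Finset.mem_image, Finset.mem_filter, Finset.mem_univ,
        true_and] at hx hy
      rcases hx with rfl | ⟨i, hi, rfl⟩ <;> rcases hy with rfl | ⟨j, hj, rfl⟩
      · exact hxy.1 rfl
      · exact hxy.2 (by rw [(hg j hj.2).2]; simpa using hj.1)
      · exact hxy.2 (by rw [(hg i hi.2).2]; simpa using hi.1)
      · rw [(hg i hi.2).2, (hg j hj.2).2] at hxy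
        by_cases hij : i = j
        · exact hxy.1 (by rw [hij])
        · exact hxy.2 (by simpa using hij)
    · intro K hKs hK hmax
      by_contra! hno
      obtain ⟨x, hxK, hx⟩ := key K hKs hK hmax a has fun h => hno a h (by simp)
      have hxs := hKs hxK
      -- As `φ x` is disjoint from `φ a` and no larger, it is a singleton: two sets of size two
      -- would be complementary.
      have hcard : (φ x).card = 1 := by
        have h1 := (hφ x).card_pos
        have h2 := hmaxa x hxs
        have h3 := Finset.card_union_of_disjoint hx
        have h4 := Finset.card_le_univ (φ a ∪ φ x)
        by_contra h5
        refine hc ⟨x, hxs, ?_⟩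
        have : φ a ∪ φ x = Finset.univ := Finset.eq_univ_of_card _ (by omega)
        exact (IsCompl.of_eq (Finset.disjoint_iff_inter_eq_empty.1 hx) this).compl_eq.symm
      obtain ⟨i, hi⟩ := Finset.card_eq_one.1 hcard
      have hex : ∃ x ∈ s, φ x = {i} := ⟨x, hxs, hi⟩
      have hia : i ∉ φ a := by rw [hi] at hx; simpa using hx
      obtain ⟨y, hyK, hy⟩ := key K hKs hK hmax (g i) (hg i hex).1 fun h => hno _ h
        (Finset.mem_insert_of_mem (Finset.mem_image_of_mem g (by simp [hia, hex])))
      rw [(hg i hex).2, ← hi] at hy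
      exact meet K hK x hxK y hyK hy

/-- For the disjointness graph, the stable set consists of one vertex carrying the empty set, or of
all vertices whose set contains a point `i`. The point is chosen such that `{i}` occurs; if no
singleton occurs, any point will do, provided there is an edge; without edges, the whole vertex set
is stable. -/
theorem isPerfect_of_adj_iff_disjoint [Finite α] (hι : Fintype.card ι ≤ 4)
    (hG : ∀ a b, G.Adj a b ↔ a ≠ b ∧ Disjoint (φ a) (φ b)) : IsPerfect G := by
  classical
  refine isPerfect_of_stable_transversal fun s hs => ?_
  by_cases h0 : ∃ a ∈ s, φ a = ∅
  · obtain ⟨a, has, ha⟩ := h0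
    refine ⟨{a}, by simpa using has, by simp, fun K hKs hK hmax => ⟨a, ?_, by simp⟩⟩
    exact mem_of_adj_maximum_clique hKs hK hmax has fun y _ hay => (hG a y).2 ⟨hay, by simp [ha]⟩
  push Not at h0
  have hstar : ∀ i, ∀ a ∈ s.filter (fun a => i ∈ φ a), ∀ b ∈ s.filter (fun a => i ∈ φ a),
      ¬ G.Adj a b := fun i a ha b hb hab =>
    Finset.disjoint_left.1 ((hG a b).1 hab).2 (Finset.mem_filter.1 ha).2 (Finset.mem_filter.1 hb).2
  by_cases h1 : ∃ i, ∃ a ∈ s, φ a = {i}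
  · obtain ⟨i, a, has, ha⟩ := h1
    refine ⟨s.filter fun a => i ∈ φ a, Finset.filter_subset _ _, hstar i, fun K hKs hK hmax => ?_⟩
    by_contra! hno
    have hi : ∀ y ∈ K, i ∉ φ y := fun y hy hiy => hno y hy (by simp [hKs hy, hiy])
    refine hno a (mem_of_adj_maximum_clique hKs hK hmax has fun y hy hay =>
      (hG a y).2 ⟨hay, ?_⟩) (by simp [has, ha])
    rw [ha]
    simpa using hi y hy
  push Not at h1
  have h2 : ∀ a ∈ s, 2 ≤ (φ a).card := by
    intro a ha
    have h3 := Finset.card_pos.2 (h0 a ha)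
    by_contra h4
    obtain ⟨i, hi⟩ := Finset.card_eq_one.1 (show (φ a).card = 1 by omega)
    exact h1 i a ha hi
  by_cases he : ∃ a ∈ s, ∃ b ∈ s, G.Adj a b
  · obtain ⟨a, ha, b, hb, hab⟩ := he
    obtain ⟨i, -⟩ := h0 a ha
    refine ⟨s.filter fun a => i ∈ φ a, Finset.filter_subset _ _, hstar i, fun K hKs hK hmax => ?_⟩
    by_contra! hno
    have hi : ∀ y ∈ K, i ∉ φ y := fun y hy hiy => hno y hy (by simp [hKs hy, hiy])
    have hK2 : 1 < K.card := lt_of_lt_of_le (by rw [Finset.card_pair hab.ne]; norm_num)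
      (hmax {a, b} (by simp [Finset.insert_subset_iff, ha, hb]) (by
        rw [Finset.coe_pair, SimpleGraph.isClique_pair]
        exact fun _ => hab))
    obtain ⟨x, hx, y, hy, hxy⟩ := Finset.one_lt_card.1 hK2
    -- Two disjoint sets with at least two points each would leave no room for `i`.
    have h3 := Finset.card_union_of_disjoint ((hG x y).1 (hK hx hy hxy)).2
    have h4 : (φ x ∪ φ y).card < Fintype.card ι := Finset.card_lt_univ_of_notMem (x := i)
      (by simp [hi x hx, hi y hy])
    have := h2 x (hKs hx)
    have := h2 y (hKs hy)
    omega
  · push Not at he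
    refine ⟨s, subset_rfl, he, fun K hKs hK hmax => ?_⟩
    obtain ⟨a, ha⟩ := hs
    obtain ⟨x, hx⟩ := Finset.card_pos.1 (lt_of_lt_of_le (by simp)
      (hmax {a} (by simpa using ha) (by simp)))
    exact ⟨x, hx, hKs hx⟩

/-- In a chordless cycle, the set at a vertex meets the disjoint sets at its two neighbors; so it
has at least two points. The vertices at positions `1` and `3` then carry disjoint sets of size two,
which takes four points. -/
theorem isChordal_of_adj_iff_not_disjoint (hι : Fintype.card ι ≤ 3)
    (hG : ∀ a b, G.Adj a b ↔ a ≠ b ∧ ¬ Disjoint (φ a) (φ b)) : IsChordal G := by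
  refine isChordal_of_forall_path fun v hv hv' => ?_
  have hd : ∀ i < 3, Disjoint (φ (v i)) (φ (v (i + 2))) := fun i hi => by
    by_contra h
    exact (hv' i hi).2 ((hG _ _).2 ⟨(hv' i hi).1, h⟩)
  have h2 : ∀ i < 3, 2 ≤ (φ (v (i + 1))).card := by
    intro i hi
    have h1 := ((hG _ _).1 (hv i (by omega))).2
    have h2 := ((hG _ _).1 (hv (i + 1) (by omega))).2
    obtain ⟨x, hx, hx'⟩ := Finset.not_disjoint_iff.1 h1
    obtain ⟨y, hy, hy'⟩ := Finset.not_disjoint_iff.1 h2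
    refine Finset.one_lt_card.2 ⟨x, hx', y, hy, fun he => ?_⟩
    exact Finset.disjoint_left.1 (hd i hi) hx (he ▸ hy')
  have h3 := Finset.card_union_of_disjoint (hd 1 (by norm_num))
  have h4 := Finset.card_le_univ (φ (v 1) ∪ φ (v (1 + 2)))
  have h5 := h2 0 (by norm_num)
  have h6 := h2 2 (by norm_num)
  simp only [Nat.reduceAdd] at h3 h4 h5 h6
  omega

/-- In a chordless cycle, the set at a vertex avoids the two distinct sets at its neighbors, whose
union has at least two points; so it has at most one point. The vertices at positions `1` and `3`
then carry the same set, as these intersect. -/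
theorem isChordal_of_adj_iff_disjoint_of_injective (hφ : Function.Injective φ)
    (hι : Fintype.card ι ≤ 3) (hG : ∀ a b, G.Adj a b ↔ a ≠ b ∧ Disjoint (φ a) (φ b)) :
    IsChordal G := by
  refine isChordal_of_forall_path fun v hv hv' => ?_
  have hd : ∀ i < 3, ¬ Disjoint (φ (v i)) (φ (v (i + 2))) := fun i hi h =>
    (hv' i hi).2 ((hG _ _).2 ⟨(hv' i hi).1, h⟩)
  have h1 : ∀ i < 3, (φ (v (i + 1))).card ≤ 1 := by
    intro i hi
    have h1 := ((hG _ _).1 (hv i (by omega))).2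
    have h2 := ((hG _ _).1 (hv (i + 1) (by omega))).2
    have h3 := Finset.card_union_of_disjoint (Finset.disjoint_union_left.2 ⟨h1, h2.symm⟩)
    have h4 := Finset.card_le_univ (φ (v i) ∪ φ (v (i + 2)) ∪ φ (v (i + 1)))
    have h5 : 1 < (φ (v i) ∪ φ (v (i + 2))).card := by
      obtain ⟨x, hx, hx'⟩ := Finset.not_disjoint_iff.1 (hd i hi)
      by_contra hle
      have hsub := Finset.card_le_one.1 (not_lt.1 hle)
      refine (hv' i hi).1 (hφ (Finset.ext fun y => ⟨fun hy => ?_, fun hy => ?_⟩))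
      · rwa [hsub y (by simp [hy]) x (by simp [hx])]
      · rwa [hsub y (by simp [hy]) x (by simp [hx])]
    simp only [Nat.add_assoc, Nat.reduceAdd] at h3 h4 h5 ⊢
    omega
  obtain ⟨x, hx, hx'⟩ := Finset.not_disjoint_iff.1 (hd 1 (by norm_num))
  have e1 := Finset.card_le_one.1 (h1 0 (by norm_num))
  have e3 := Finset.card_le_one.1 (h1 2 (by norm_num))
  refine (hv' 1 (by norm_num)).1 (hφ (Finset.ext fun y => ⟨fun hy => ?_, fun hy => ?_⟩))
  · rwa [e1 y hy x hx]
  · rwa [e3 y hy x hx']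

end Families

/-! ### Supports of vectors -/

section Vectors

variable {ι F V : Type*} [Field F] [AddCommGroup V] [Module F V] (B : Module.Basis ι F V)

/-- The skeleton of a nonzero vector, as a set of indices of basis vectors. -/
noncomputable def indexSupport (a : {a : V // a ≠ 0}) : Finset ι := (B.repr a.1).support

variable {B}

theorem mem_indexSupport {a : {a : V // a ≠ 0}} {i : ι} :
    i ∈ indexSupport B a ↔ B.repr a.1 i ≠ 0 := Finsupp.mem_support_iff

theorem indexSupport_nonempty (a : {a : V // a ≠ 0}) : (indexSupport B a).Nonempty := by
  rw [indexSupport, Finsupp.support_nonempty_iff]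
  simpa using a.2

theorem skeleton_eq_image (a : {a : V // a ≠ 0}) : skeleton B a.1 = B '' indexSupport B a := by
  ext v
  simp only [skeleton, Set.mem_ofPred_eq, Set.mem_image, Finset.mem_coe, mem_indexSupport]
  exact exists_congr fun i => and_comm

theorem interGraph_adj {a b : {a : V // a ≠ 0}} : (interGraph B).Adj a b ↔
    a ≠ b ∧ ¬ Disjoint (indexSupport B a) (indexSupport B b) := by
  change a ≠ b ∧ (skeleton B a.1 ∩ skeleton B b.1).Nonempty ↔ _
  rw [skeleton_eq_image, skeleton_eq_image, ← Set.image_inter B.injective, Set.image_nonempty,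
    ← Finset.disjoint_coe, Set.not_disjoint_iff_nonempty_inter]

theorem unionGraph_adj [Fintype ι] [DecidableEq ι] {a b : {a : V // a ≠ 0}} :
    (unionGraph B).Adj a b ↔ a ≠ b ∧ Disjoint (indexSupport B a)ᶜ (indexSupport B b)ᶜ := by
  change a ≠ b ∧ skeleton B a.1 ∪ skeleton B b.1 = Set.range B ↔ _
  rw [skeleton_eq_image, skeleton_eq_image, ← Set.image_union, ← Set.image_univ,
    B.injective.image_injective.eq_iff, ← Finset.coe_union, ← Finset.coe_univ, Finset.coe_inj,
    Finset.disjoint_iff_inter_eq_empty, ← Finset.compl_union, Finset.compl_eq_empty_iff]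

theorem exists_indexSupport_eq [Fintype ι] {t : Finset ι} (ht : t.Nonempty) {c : F} (hc : c ≠ 0) :
    ∃ a : {a : V // a ≠ 0}, indexSupport B a = t ∧ ∀ i ∈ t, B.repr a.1 i = c := by
  classical
  have hr : ∀ i, B.repr (B.equivFun.symm fun i => if i ∈ t then c else 0) i =
      if i ∈ t then c else 0 := fun i => by
    rw [← B.equivFun_apply, LinearEquiv.apply_symm_apply]
  refine ⟨⟨B.equivFun.symm fun i => if i ∈ t then c else 0, fun h0 => ?_⟩, ?_, fun i hi => ?_⟩
  · obtain ⟨i, hi⟩ := ht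
    have := hr i
    rw [h0] at this
    simp [hi, hc.symm] at this
  · ext i
    rw [mem_indexSupport]
    change B.repr (B.equivFun.symm fun i => if i ∈ t then c else 0) i ≠ 0 ↔ i ∈ t
    rw [hr]
    by_cases hi : i ∈ t <;> simp [hi, hc]
  · simpa [hi] using hr i

theorem exists_compl_indexSupport_eq [Fintype ι] [DecidableEq ι] {t : Finset ι}
    (ht : t.card < Fintype.card ι) {c : F} (hc : c ≠ 0) :
    ∃ a : {a : V // a ≠ 0}, (indexSupport B a)ᶜ = t ∧ ∀ i ∉ t, B.repr a.1 i = c := by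
  obtain ⟨a, ha, ha'⟩ := exists_indexSupport_eq (B := B) (t := tᶜ)
    (by rw [← Finset.card_pos, Finset.card_compl]; omega) hc
  exact ⟨a, by rw [ha, compl_compl], fun i hi => ha' i (by simpa using hi)⟩

/-- Over the field with two elements, a vector is determined by its support. -/
theorem indexSupport_injective (hF : Nat.card F = 2) :
    Function.Injective (indexSupport B) := by
  obtain ⟨u, -, hu⟩ := (Nat.card_eq_two_iff' (0 : F)).1 hF
  refine fun a b hab => Subtype.ext (B.repr.injective (Finsupp.ext fun i => ?_))
  have h : B.repr a.1 i ≠ 0 ↔ B.repr b.1 i ≠ 0 := by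
    rw [← mem_indexSupport, hab, mem_indexSupport]
  by_cases ha : B.repr a.1 i = 0
  · rw [ha, not_not.1 (fun hb => h.2 hb ha)]
  · rw [hu _ ha, hu _ (h.1 ha)]

/-! ### The four graph properties in terms of the dimension -/

variable [Fintype ι]

theorem isChordal_interGraph_iff : IsChordal (interGraph B) ↔ Fintype.card ι ≤ 3 := by
  classical
  refine ⟨fun h => ?_, fun h => isChordal_of_adj_iff_not_disjoint h fun _ _ => interGraph_adj⟩
  by_contra! hι
  obtain ⟨e⟩ := Function.Embedding.nonempty_of_card_le (α := Fin 4) (β := ι)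
    (by rw [Fintype.card_fin]; omega)
  -- The skeletons of the square are the edges of a 4-cycle on four basis vectors.
  have hv : ∀ i : Fin 4, ∃ a, indexSupport B a = Finset.map e {i, i + 1} := fun i =>
    (exists_indexSupport_eq (by simp) one_ne_zero).imp fun _ h => h.1
  choose v hv using hv
  have hadj : ∀ i j, (interGraph B).Adj (v i) (v j) ↔
      v i ≠ v j ∧ ¬ Disjoint ({i, i + 1} : Finset (Fin 4)) {j, j + 1} := fun i j => by
    rw [interGraph_adj, hv, hv, Finset.disjoint_map]
  have hne : ∀ i j, ({i, i + 1} : Finset (Fin 4)) ≠ {j, j + 1} → v i ≠ v j := fun i j h he =>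
    h (Finset.map_injective e (by rw [← hv, ← hv, he]))
  exact not_isChordal_of_square
    ((hadj 0 1).2 ⟨hne _ _ (by decide), by decide⟩) ((hadj 1 2).2 ⟨hne _ _ (by decide), by decide⟩)
    ((hadj 2 3).2 ⟨hne _ _ (by decide), by decide⟩) ((hadj 3 0).2 ⟨hne _ _ (by decide), by decide⟩)
    (fun h => ((hadj 0 2).1 h).2 (by decide)) (fun h => ((hadj 1 3).1 h).2 (by decide))
    (hne _ _ (by decide)) (hne _ _ (by decide)) h

theorem not_isChordal_unionGraph_of_four_le (hι : 4 ≤ Fintype.card ι) :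
    ¬ IsChordal (unionGraph B) := by
  classical
  obtain ⟨e⟩ := Function.Embedding.nonempty_of_card_le (α := Fin 4) (β := ι)
    (by rw [Fintype.card_fin]; omega)
  let t : Fin 4 → Finset (Fin 4) := ![{0}, {2}, {0, 1}, {2, 3}]
  have ht : ∀ i, (t i).card ≤ 2 := by decide
  have hv : ∀ i : Fin 4, ∃ a, (indexSupport B a)ᶜ = Finset.map e (t i) := fun i =>
    (exists_compl_indexSupport_eq (by rw [Finset.card_map]; have := ht i; omega)
      one_ne_zero).imp fun _ h => h.1
  choose v hv using hv
  have hadj : ∀ i j, (unionGraph B).Adj (v i) (v j) ↔ v i ≠ v j ∧ Disjoint (t i) (t j) :=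
    fun i j => by rw [unionGraph_adj, hv, hv, Finset.disjoint_map]
  have hne : ∀ i j, t i ≠ t j → v i ≠ v j := fun i j h he =>
    h (Finset.map_injective e (by rw [← hv, ← hv, he]))
  exact not_isChordal_of_square
    ((hadj 0 1).2 ⟨hne _ _ (by decide), by decide⟩) ((hadj 1 2).2 ⟨hne _ _ (by decide), by decide⟩)
    ((hadj 2 3).2 ⟨hne _ _ (by decide), by decide⟩) ((hadj 3 0).2 ⟨hne _ _ (by decide), by decide⟩)
    (fun h => absurd ((hadj 0 2).1 h).2 (by decide))
    (fun h => absurd ((hadj 1 3).1 h).2 (by decide))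
    (hne _ _ (by decide)) (hne _ _ (by decide))

theorem not_isChordal_unionGraph_of_card_ne_two (hι : 2 ≤ Fintype.card ι) (hF : Nat.card F ≠ 2) :
    ¬ IsChordal (unionGraph B) := by
  classical
  obtain ⟨x, y, hxy⟩ := Fintype.exists_pair_of_one_lt_card (α := ι) hι
  obtain ⟨c, hc0, hc1⟩ : ∃ c : F, c ≠ 0 ∧ c ≠ 1 := by
    by_contra! h
    exact hF ((Nat.card_eq_two_iff' (0 : F)).2 ⟨1, one_ne_zero, h⟩)
  have hv : ∀ (i : ι) (d : F), d ≠ 0 → ∃ a, (indexSupport B a)ᶜ = {i} ∧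
      ∀ j ∉ ({i} : Finset ι), B.repr a.1 j = d := fun i d hd =>
    exists_compl_indexSupport_eq (by rw [Finset.card_singleton]; omega) hd
  obtain ⟨a, ha, ha'⟩ := hv x 1 one_ne_zero
  obtain ⟨b, hb, hb'⟩ := hv x c hc0
  obtain ⟨a₂, ha₂, ha₂'⟩ := hv y 1 one_ne_zero
  obtain ⟨b₂, hb₂, hb₂'⟩ := hv y c hc0
  have hadj : ∀ {u v : {a : V // a ≠ 0}} {i j : ι}, (indexSupport B u)ᶜ = {i} →
      (indexSupport B v)ᶜ = {j} → i ≠ j → (unionGraph B).Adj u v := by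
    intro u v i j hu hv hij
    refine unionGraph_adj.2 ⟨fun he => hij ?_, by simpa [hu, hv] using hij⟩
    subst he
    exact Finset.singleton_injective (hu.symm.trans hv)
  have hnadj : ∀ {u v : {a : V // a ≠ 0}} {i : ι}, (indexSupport B u)ᶜ = {i} →
      (indexSupport B v)ᶜ = {i} → ¬ (unionGraph B).Adj u v := by
    intro u v i hu hv h
    have := (unionGraph_adj.1 h).2
    simp [hu, hv] at this
  refine not_isChordal_of_square (hadj ha ha₂ hxy) (hadj ha₂ hb hxy.symm) (hadj hb hb₂ hxy)
    (hadj hb₂ ha hxy.symm) (hnadj ha hb) (hnadj ha₂ hb₂) (fun he => hc1 ?_) (fun he => hc1 ?_)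
  · rw [← hb' y (by simpa using hxy.symm), ← he, ha' y (by simpa using hxy.symm)]
  · rw [← hb₂' x (by simpa using hxy), ← he, ha₂' x (by simpa using hxy)]

theorem isChordal_unionGraph_of_card_eq_one (hι : Fintype.card ι = 1) :
    IsChordal (unionGraph B) := by
  classical
  have h0 : ∀ a : {a : V // a ≠ 0}, (indexSupport B a)ᶜ = ∅ := fun a => by
    have := (indexSupport_nonempty (B := B) a).card_pos
    rw [← Finset.card_eq_zero, Finset.card_compl]
    omega
  exact isChordal_of_forall_path fun v _ hv => (hv 0 (by norm_num)).2
    (unionGraph_adj.2 ⟨(hv 0 (by norm_num)).1, by simp [h0]⟩)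

theorem isChordal_unionGraph_iff (hι : 0 < Fintype.card ι) : IsChordal (unionGraph B) ↔
    Fintype.card ι = 1 ∨ ((Fintype.card ι = 2 ∨ Fintype.card ι = 3) ∧ Nat.card F = 2) := by
  classical
  constructor
  · intro h
    by_cases h4 : 4 ≤ Fintype.card ι
    · exact absurd h (not_isChordal_unionGraph_of_four_le h4)
    by_cases h1 : Fintype.card ι = 1
    · exact Or.inl h1
    refine Or.inr ⟨by omega, ?_⟩
    by_contra hF
    exact not_isChordal_unionGraph_of_card_ne_two (by omega) hF h
  · rintro (h | ⟨h, hF⟩)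
    · exact isChordal_unionGraph_of_card_eq_one h
    · exact isChordal_of_adj_iff_disjoint_of_injective
        (compl_injective.comp (indexSupport_injective hF)) (by omega) fun _ _ => unionGraph_adj

theorem isPerfect_interGraph_iff [Finite V] :
    IsPerfect (interGraph B) ↔ Fintype.card ι ≤ 4 := by
  classical
  refine ⟨fun h => ?_, fun h => isPerfect_of_adj_iff_not_disjoint h indexSupport_nonempty
    fun _ _ => interGraph_adj⟩
  by_contra! hι
  obtain ⟨e⟩ := Function.Embedding.nonempty_of_card_le (α := Fin 5) (β := ι)
    (by rw [Fintype.card_fin]; omega)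
  have hv : ∀ i : Fin 5, ∃ a, indexSupport B a = Finset.map e {i, i + 1} := fun i =>
    (exists_indexSupport_eq (by simp) one_ne_zero).imp fun _ h => h.1
  choose v hv using hv
  have hinj : Function.Injective v := fun i j he => by
    have : ({i, i + 1} : Finset (Fin 5)) = {j, j + 1} :=
      Finset.map_injective e (by rw [← hv, ← hv, he])
    clear he
    revert i j
    decide
  refine not_isPerfect_of_pentagon v (fun i j => ?_) h
  rw [interGraph_adj, hinj.ne_iff, hv, hv, Finset.disjoint_map]
  revert i j
  decide

theorem isPerfect_unionGraph_iff [Finite V] :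
    IsPerfect (unionGraph B) ↔ Fintype.card ι ≤ 4 := by
  classical
  refine ⟨fun h => ?_, fun h => isPerfect_of_adj_iff_disjoint h fun _ _ => unionGraph_adj⟩
  by_contra! hι
  obtain ⟨e⟩ := Function.Embedding.nonempty_of_card_le (α := Fin 5) (β := ι)
    (by rw [Fintype.card_fin]; omega)
  -- The pairs `{2i, 2i + 1}` modulo `5`: consecutive ones are disjoint, the others intersect.
  have hv : ∀ i : Fin 5, ∃ a, (indexSupport B a)ᶜ = Finset.map e {2 * i, 2 * i + 1} := fun i =>
    (exists_compl_indexSupport_eq (by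
      rw [Finset.card_map]
      have := Finset.card_le_two (a := 2 * i) (b := 2 * i + 1)
      omega) one_ne_zero).imp fun _ h => h.1
  choose v hv using hv
  have hinj : Function.Injective v := fun i j he => by
    have : ({2 * i, 2 * i + 1} : Finset (Fin 5)) = {2 * j, 2 * j + 1} :=
      Finset.map_injective e (by rw [← hv, ← hv, he])
    clear he
    revert i j
    decide
  refine not_isPerfect_of_pentagon v (fun i j => ?_) h
  rw [unionGraph_adj, hinj.ne_iff, hv, hv, Finset.disjoint_map]
  revert i j
  decide

end Vectors

end SkeletonGraphs

theorem mainTheorem5 {ι F V : Type*} [Field F] [Finite F] [AddCommGroup V] [Module F V]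
    [FiniteDimensional F V] (B : Module.Basis ι F V) :
    (SkeletonGraphs.IsChordal (SkeletonGraphs.interGraph B) ↔ Module.finrank F V ≤ 3) ∧
    (Nontrivial V →
      (SkeletonGraphs.IsChordal (SkeletonGraphs.unionGraph B) ↔
        Module.finrank F V = 1 ∨
          ((Module.finrank F V = 2 ∨ Module.finrank F V = 3) ∧ Nat.card F = 2))) ∧
    (SkeletonGraphs.IsPerfect (SkeletonGraphs.interGraph B) ↔
      SkeletonGraphs.IsPerfect (SkeletonGraphs.unionGraph B)) ∧
    (SkeletonGraphs.IsPerfect (SkeletonGraphs.unionGraph B) ↔ Module.finrank F V ≤ 4) := by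
  have := Module.Finite.finite_basis B
  have := Fintype.ofFinite ι
  have := Module.finite_of_finite F (M := V)
  have hr := Module.finrank_eq_card_basis B
  rw [SkeletonGraphs.isPerfect_interGraph_iff, SkeletonGraphs.isPerfect_unionGraph_iff, hr]
  refine ⟨SkeletonGraphs.isChordal_interGraph_iff, fun hV => ?_, Iff.rfl, Iff.rfl⟩
  exact SkeletonGraphs.isChordal_unionGraph_iff (hr ▸ Module.finrank_pos)
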